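/- Conventions. For points $x,y,z$ of a metric space $X$ let $(y,z)_x=\frac12\big(d(x,y)+d(x,z)-d(y,z)\big)$. $X$ is $\delta$-hyperbolic if $(x,z)_w\ge\min\{(x,y)_w,(y,z)_w\}-\delta$ for all $x,y,z,w\in X$. The Gromov boundary $\partial X$ is the set of classes of sequences with $\lim_{n,m}(z_n,z_m)_x=+\infty$, where $(z_n)\approx(z_n')$ if $\lim_{n,m}(z_n,z'_m)_x=+\infty$; for $z,z'\in\partial X$ put $(z,z')_x=\sup\liminf_{n,m}(z_n,z'_m)_x$, the supremum being over all sequences $(z_n)\in z$, $(z_n')\in z'$. For $\delta>0$ let $a_\delta=\frac{1}{4\delta\log_2 e}$. A metric $D_x$ on $\partial X$ is a standard visual metric of center $x\in X$ and parameter $a_\delta$ if $$(3-2e^{a_\delta\delta})\,e^{-a_\delta (z,z')_x}\le D_x(z,z')\le e^{-a_\delta (z,z')_x}\qquad\text{for all } z,z'\in\partial X .$$ The limit set $\Lambda(\Gamma)\subseteq\partial X$ of a group $\Gamma$ of isometries of $X$ is the set of accumulation points in $\partial X$ of an orbit $\Gamma x$. The quasiconvex hull $\mathrm{QC\text{-}Hull}(C)$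 of $C\subseteq\partial X$ is the union of all geodesic lines of $X$ joining two points of $C$. $\mathcal M(\delta,D)$ is the class of triples $(X,x,\Gamma)$ where $X$ is a proper geodesic $\delta$-hyperbolic metric space, $\Gamma$ is a group of isometries of $X$ that is discrete (in the compact-open topology), torsion-free and non-elementary ($\#\Lambda(\Gamma)>2$), and quasiconvex-cocompact with codiameter at most $D$ (for all $y,y'\in\mathrm{QC\text{-}Hull}(\Lambda(\Gamma))$ there is $g\in\Gamma$ with $d(gy,y')\le D$), and $x\in\mathrm{QC\text{-}Hull}(\Lambda(\Gamma))$. For $L_0\ge1$ and $\rho_0>0$, a compact metric space $(Y,d)$ is $(L_0,\rho_0)$-quasi-selfsimilar if for every $z\in Y$ and $0<\rho\le\rho_0$ there is a map $\Phi:B(z,\rho)\to Y$ such that $$\tfrac1{L_0}\tfrac{\rho_0}{\rho}\,d(w,w')\le d(\Phi(w),\Phi(w'))\le L_0\tfrac{\rho_0}{\rho}\,d(w,w')\quad (w,w'\in B(z,\rho))\quad\text{and}\quad \Phi(B(z,\rho))\supseteq B\big(\Phi(z),\tfrac{\rho_0}{L_0}\big),$$ where the balls are open balls of $Y$. Proposition.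 Let $\delta>0$ and $D\ge0$. There are $L_0=L_0(\delta,D)\ge1$ and $\rho_0=\rho_0(\delta,D)>0$ such that for every $(X,x,\Gamma)\in\mathcal M(\delta,D)$ and every standard visual metric $D_x$ on $\partial X$ of center $x$ and parameter $a_\delta$, the metric space $(\Lambda(\Gamma),D_x)$ is compact and $(L_0,\rho_0)$-quasi-selfsimilar. Moreover, for every $z\in\Lambda(\Gamma)$ and $0<\rho\le\rho_0$ the map $\Phi$ can be chosen to be the restriction to $B(z,\rho)\cap\Lambda(\Gamma)$ of the map of $\partial X$ induced by some $g\in\Gamma$. -/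

import Mathlib

open Filter Set

/-- The Gromov product `(y, z)_x`. -/
noncomputable def gromovProduct {X : Type*} [MetricSpace X] (x y z : X) : ℝ :=
  (dist x y + dist x z - dist y z) / 2

/-- `X` is `δ`-hyperbolic (four-point condition). -/
def IsDeltaHyperbolic (δ : ℝ) (X : Type*) [MetricSpace X] : Prop :=
  ∀ x y z w : X,
    min (gromovProduct w x y) (gromovProduct w y z) - δ ≤ gromovProduct w x z

/-- `X` is geodesic: between any two points there are points at all intermediate distances
(for complete spaces this is the existence of geodesic segments). -/
def IsGeodesicSpace (X : Type*) [MetricSpace X] : Prop :=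
  ∀ x y : X, ∀ t ∈ Icc (0 : ℝ) (dist x y), ∃ z : X, dist x z = t ∧ dist z y = dist x y - t

/-- `lim_{n,m → ∞} (u_n, v_m)_x = +∞` (for one, equivalently for every, base point `x`). -/
def GromovAsymptotic {X : Type*} [MetricSpace X] (u v : ℕ → X) : Prop :=
  ∀ x : X, Tendsto (fun p : ℕ × ℕ => gromovProduct x (u p.1) (v p.2)) atTop atTop

/-- Sequences `(u_n)` with `lim_{n,m → ∞} (u_n, u_m)_x = +∞`. -/
def GromovSequence (X : Type*) [MetricSpace X] : Type _ :=
  {u : ℕ → X // GromovAsymptotic u u}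

/-- The Gromov boundary `∂X`. On hyperbolic spaces the relation is already an equivalence
relation, see `GromovBoundary.mk_eq_mk_iff`. -/
def GromovBoundary (X : Type*) [MetricSpace X] : Type _ :=
  Quot (fun u v : GromovSequence X => GromovAsymptotic u.1 v.1)

/-- The point of `∂X` represented by a sequence. -/
def GromovBoundary.mk {X : Type*} [MetricSpace X] (u : GromovSequence X) : GromovBoundary X :=
  Quot.mk _ u

theorem gromovProduct_comm {X : Type*} [MetricSpace X] (x y z : X) :
    gromovProduct x y z = gromovProduct x z y := by
  simp only [gromovProduct, dist_comm y z]; ring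

theorem GromovAsymptotic.symm {X : Type*} [MetricSpace X] {u v : ℕ → X}
    (h : GromovAsymptotic u v) : GromovAsymptotic v u := by
  intro x
  have h1 : Tendsto (fun p : ℕ × ℕ => (p.2, p.1)) atTop atTop := by
    rw [← prod_atTop_atTop_eq]
    exact tendsto_snd.prodMk tendsto_fst
  exact ((h x).comp h1).congr fun p => gromovProduct_comm _ _ _

theorem GromovAsymptotic.trans {X : Type*} [MetricSpace X] {δ : ℝ}
    (hX : IsDeltaHyperbolic δ X) {u v w : ℕ → X} (h1 : GromovAsymptotic u v)
    (h2 : GromovAsymptotic v w) : GromovAsymptotic u w := by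
  intro x
  rw [tendsto_atTop]
  intro b
  obtain ⟨⟨n1, m1⟩, h1'⟩ := eventually_atTop.1 (tendsto_atTop.1 (h1 x) (b + δ))
  obtain ⟨⟨n2, m2⟩, h2'⟩ := eventually_atTop.1 (tendsto_atTop.1 (h2 x) (b + δ))
  refine eventually_atTop.2 ⟨(n1, m2), fun p hp => ?_⟩
  have e1 := h1' (p.1, max m1 n2) ⟨hp.1, le_max_left _ _⟩
  have e2 := h2' (max m1 n2, p.2) ⟨le_max_right _ _, hp.2⟩
  have e3 := hX (u p.1) (v (max m1 n2)) (w p.2) x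
  have e4 := le_min e1 e2
  dsimp only at e4
  linarith

/-- On a hyperbolic space two sequences represent the same boundary point exactly when they are
asymptotic. -/
theorem GromovBoundary.mk_eq_mk_iff {X : Type*} [MetricSpace X] {δ : ℝ}
    (hX : IsDeltaHyperbolic δ X) (u v : GromovSequence X) :
    GromovBoundary.mk u = GromovBoundary.mk v ↔ GromovAsymptotic u.1 v.1 := by
  have he : Equivalence (fun u v : GromovSequence X => GromovAsymptotic u.1 v.1) :=
    ⟨fun u => u.2, fun h => h.symm, fun h1 h2 => h1.trans hX h2⟩
  exact ⟨fun h => he.eqvGen_iff.1 (Quot.eqvGen_exact h), fun h => Quot.sound h⟩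

/-- The sequence `s` in `X` converges to the boundary point `z`. -/
def ConvergesToBoundary {X : Type*} [MetricSpace X] (s : ℕ → X) (z : GromovBoundary X) : Prop :=
  ∃ h : GromovAsymptotic s s, GromovBoundary.mk ⟨s, h⟩ = z

/-- The Gromov product `(z, z')_x` of two boundary points: the supremum, over all sequences
representing `z` and `z'`, of the lower limits of the Gromov products. -/
noncomputable def boundaryGromovProduct {X : Type*} [MetricSpace X] (x : X)
    (z z' : GromovBoundary X) : EReal :=
  ⨆ (u : ℕ → X) (v : ℕ → X) (_ : ConvergesToBoundary u z) (_ : ConvergesToBoundary v z'),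
    liminf (fun p : ℕ × ℕ => ((gromovProduct x (u p.1) (v p.2) : ℝ) : EReal)) atTop

/-- The metric on `∂X` is a standard visual metric of center `x` and parameter `a`:
`0 < a < 1 / (2 δ log₂ e)` and
`(3 - 2 e^{aδ}) e^{-a (z,z')_x} ≤ D(z,z') ≤ e^{-a (z,z')_x}`, with `e^{-∞} = 0`. -/
def IsStandardVisualMetric {X : Type*} [MetricSpace X] [MetricSpace (GromovBoundary X)]
    (δ a : ℝ) (x : X) : Prop :=
  0 < a ∧ a * (2 * δ * Real.logb 2 (Real.exp 1)) < 1 ∧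
    ∀ z z' : GromovBoundary X,
      ENNReal.ofReal (3 - 2 * Real.exp (a * δ)) *
          EReal.exp (-((a : EReal) * boundaryGromovProduct x z z')) ≤ edist z z' ∧
        edist z z' ≤ EReal.exp (-((a : EReal) * boundaryGromovProduct x z z'))

/-- The parameter `a_δ = 1 / (4 δ log₂ e)`. -/
noncomputable def visualParameter (δ : ℝ) : ℝ :=
  1 / (4 * δ * Real.logb 2 (Real.exp 1))

theorem gromovProduct_isometryEquiv {X : Type*} [MetricSpace X] (g : X ≃ᵢ X) (x y z : X) :
    gromovProduct x (g y) (g z) = gromovProduct (g.symm x) y z := by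
  have h : ∀ y, dist x (g y) = dist (g.symm x) y := fun y => by
    rw [← g.dist_eq (g.symm x) y, g.apply_symm_apply]
  simp only [gromovProduct, h, g.dist_eq]

theorem GromovAsymptotic.map {X : Type*} [MetricSpace X] (g : X ≃ᵢ X) {u v : ℕ → X}
    (h : GromovAsymptotic u v) : GromovAsymptotic (fun n => g (u n)) (fun n => g (v n)) := by
  intro x
  simpa only [gromovProduct_isometryEquiv] using h (g.symm x)

/-- The map of `∂X` induced by an isometry of `X`, `[(u_n)] ↦ [(g u_n)]`. -/
def boundaryMap {X : Type*} [MetricSpace X] (g : X ≃ᵢ X) : GromovBoundary X → GromovBoundary X :=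
  Quot.map (fun u => ⟨fun n => g (u.1 n), u.2.map g⟩) (fun _ _ h => h.map g)

/-- The limit set `Λ(Γ)`: the boundary points to which some sequence of an orbit `Γ x` converges
(for one, equivalently for every, `x`). -/
def limitSet {X : Type*} [MetricSpace X] (Γ : Subgroup (X ≃ᵢ X)) : Set (GromovBoundary X) :=
  {z | ∃ (x : X) (g : ℕ → Γ), ConvergesToBoundary (fun n => (g n : X ≃ᵢ X) x) z}

/-- `QC-Hull(C)`: the union of all geodesic lines joining two points of `C ⊆ ∂X`. -/
def quasiconvexHull {X : Type*} [MetricSpace X] (C : Set (GromovBoundary X)) : Set X :=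
  {y | ∃ γ : ℝ → X, Isometry γ ∧
    (∃ z ∈ C, ConvergesToBoundary (fun n : ℕ => γ n) z) ∧
    (∃ z' ∈ C, ConvergesToBoundary (fun n : ℕ => γ (-(n : ℝ))) z') ∧ y ∈ range γ}

/-- The class `M(δ, D)` of triples `(X, x, Γ)`. -/
structure MClass {X : Type*} [MetricSpace X] (δ D : ℝ) (x : X) (Γ : Subgroup (X ≃ᵢ X)) :
    Prop where
  proper : ProperSpace X
  geodesic : IsGeodesicSpace X
  hyperbolic : IsDeltaHyperbolic δ X
  /-- `Γ` is discrete in the compact-open topology. -/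
  discrete : DiscreteTopology
    ((fun g : X ≃ᵢ X => (g.toHomeomorph : C(X, X))) '' (Γ : Set (X ≃ᵢ X)))
  nonelementary : 2 < (limitSet Γ).encard
  torsion_free : ∀ g ∈ Γ, IsOfFinOrder g → g = 1
  /-- `Γ` is quasiconvex-cocompact with codiameter at most `D`. -/
  cocompact : ∀ y ∈ quasiconvexHull (limitSet Γ), ∀ y' ∈ quasiconvexHull (limitSet Γ),
    ∃ g ∈ Γ, dist (g y) y' ≤ D
  base_mem : x ∈ quasiconvexHull (limitSet Γ)

/-- `Φ : (B(z,ρ), (ρ₀/ρ) d) → Y` is `L₀`-biLipschitz and its image contains `B(Φ(z), ρ₀/L₀)`. -/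
def IsRescalingMap {Y : Type*} [MetricSpace Y] (L₀ ρ₀ : ℝ) (z : Y) (ρ : ℝ) (hρ : 0 < ρ)
    (Φ : Metric.ball z ρ → Y) : Prop :=
  (∀ w w' : Metric.ball z ρ,
    1 / L₀ * (ρ₀ / ρ * dist w w') ≤ dist (Φ w) (Φ w') ∧
      dist (Φ w) (Φ w') ≤ L₀ * (ρ₀ / ρ * dist w w')) ∧
  Metric.ball (Φ ⟨z, Metric.mem_ball_self hρ⟩) (ρ₀ / L₀) ⊆ range Φ

/-- `Y` is a compact, `(L₀, ρ₀)`-quasi-selfsimilar metric space. -/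
def IsQuasiSelfSimilar (L₀ ρ₀ : ℝ) (Y : Type*) [MetricSpace Y] : Prop :=
  1 ≤ L₀ ∧ 0 < ρ₀ ∧ CompactSpace Y ∧
    ∀ (z : Y) (ρ : ℝ) (hρ : 0 < ρ), ρ ≤ ρ₀ →
      ∃ Φ : Metric.ball z ρ → Y, IsRescalingMap L₀ ρ₀ z ρ hρ Φ

/-!
The statement says that the action of `Γ` on its limit set magnifies small balls to a fixed size
with uniformly bounded distortion. The scale `exp (-(a * T))` at a limit point `z` is seen from a point
`y` of `X` at distance about `T` from `x` in the direction of `z`. For boundary points `w, w'` so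
close to `z` that they lie in the shadow of `y`, moving the base point from `x` to `y` changes
`(w, w')` by `-T` up to a bounded error, by the identity
`(u, v)_x - (u, v)_y = (y, u)_x + (y, v)_x - d(x, y)`. An isometry `g` with `d(g y, x) ≤ D` then
multiplies the visual distance of `w` and `w'` by `exp (a * T)` up to a bounded factor
(`IsStandardVisualMetric.dist_boundaryMap_bounds`). Conversely, a boundary point whose image is
close to `g z` is close to `z` at the original scale
(`IsStandardVisualMetric.dist_le_of_dist_boundaryMap_lt`).

By cocompactness such a `g ∈ Γ` exists as soon as `y` lies in the quasiconvex hull of the limit set.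
So it has to be shown that every limit point is the end of a geodesic line of the hull which passes
within a uniform distance of `x` (`exists_line_of_mem_quasiconvexHull`): the base point `x` lies on
a line of the hull, one of whose ends has a bounded Gromov product with `z`, and the line joining
this end to `z` is an ultrafilter limit of finite chains (`exists_isometry_line`).

The limit set is compact because the boundary of a proper space is totally bounded and because a
Cauchy sequence of limit points is shadowed by a sequence of orbit points that converges to its
limit.

All Gromov products of boundary points are handled through representing sequences:
`IsStandardVisualMetric.dist_le`, `IsStandardVisualMetric.eventually_le_gromovProduct` and
`IsStandardVisualMetric.dist_le_mul_dist` translate between Gromov products of sequences and visual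
distances.
-/

/-! ### Gromov products -/

section GromovProduct

variable {X : Type*} [MetricSpace X]

theorem gromovProduct_self (x y : X) : gromovProduct x y y = dist x y := by
  simp [gromovProduct]

theorem gromovProduct_nonneg (x y z : X) : 0 ≤ gromovProduct x y z := by
  have := dist_triangle_left y z x
  unfold gromovProduct
  linarith

theorem gromovProduct_le_dist (x y z : X) : gromovProduct x y z ≤ dist x y := by
  have := dist_triangle x y z
  unfold gromovProduct
  linarith

theorem gromovProduct_add_gromovProduct (x y z : X) :
    gromovProduct x y z + gromovProduct y x z = dist x y := by
  simp only [gromovProduct, dist_comm y x]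
  ring

theorem gromovProduct_sub_gromovProduct (x y u v : X) :
    gromovProduct x u v - gromovProduct y u v =
      gromovProduct x y u + gromovProduct x y v - dist x y := by
  simp only [gromovProduct]
  ring

theorem gromovProduct_le_add_dist_base (x x' y z : X) :
    gromovProduct x y z ≤ gromovProduct x' y z + dist x x' := by
  have h1 := dist_triangle x x' y
  have h2 := dist_triangle x x' z
  unfold gromovProduct
  linarith

theorem gromovProduct_le_add_dist_left (x y y' z : X) :
    gromovProduct x y z ≤ gromovProduct x y' z + dist y y' := by
  have h1 := dist_triangle x y' y
  have h2 := dist_triangle y' y z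
  rw [dist_comm y' y] at h1 h2
  unfold gromovProduct
  linarith

theorem IsDeltaHyperbolic.nonneg {δ : ℝ} (hX : IsDeltaHyperbolic δ X) (x : X) : 0 ≤ δ := by
  simpa [gromovProduct] using hX x x x x

theorem IsDeltaHyperbolic.le_gromovProduct {δ : ℝ} (hX : IsDeltaHyperbolic δ X) {w x y z : X}
    {r : ℝ} (h1 : r ≤ gromovProduct w x y) (h2 : r ≤ gromovProduct w y z) :
    r - δ ≤ gromovProduct w x z := by
  have := hX x y z w
  have := le_min h1 h2
  linarith

/-- In a hyperbolic space, a point of an (approximate) geodesic from `u` to `v` that is placed like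
the internal point of the triangle `x, u, v` lies at distance about `(u, v)_x` from `x`. -/
theorem IsDeltaHyperbolic.dist_internal_point_le {δ : ℝ} (hX : IsDeltaHyperbolic δ X)
    {x u v p : X} {ε : ℝ} (h1 : dist u p ≤ gromovProduct u x v + ε)
    (h2 : dist p v ≤ gromovProduct v x u + ε) :
    dist x p ≤ gromovProduct x u v + 2 * δ + ε := by
  have h := hX u x v p
  unfold gromovProduct at h h1 h2 ⊢
  simp only [dist_comm v, dist_comm p u, dist_comm p x, dist_comm u x] at h h1 h2 ⊢
  rcases min_cases ((dist u p + dist x p - dist x u) / 2)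
    ((dist x p + dist p v - dist x v) / 2) with ⟨e, -⟩ | ⟨e, -⟩ <;> rw [e] at h <;> linarith

theorem gromovAsymptotic_iff (x : X) {u v : ℕ → X} :
    GromovAsymptotic u v ↔
      ∀ r : ℝ, ∃ N, ∀ n m, N ≤ n → N ≤ m → r ≤ gromovProduct x (u n) (v m) := by
  constructor
  · intro h r
    exact eventually_atTop_prod_self.1 (tendsto_atTop.1 (h x) r)
  · intro h y
    refine tendsto_atTop.2 fun r => eventually_atTop_prod_self.2 ?_
    obtain ⟨N, hN⟩ := h (r + dist x y)
    refine ⟨N, fun n m hn hm => ?_⟩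
    have h1 := hN n m hn hm
    have h2 := gromovProduct_le_add_dist_base x y (u n) (v m)
    dsimp only
    linarith

theorem GromovAsymptotic.of_dist_le {u v : ℕ → X} (h : GromovAsymptotic u u) {B : ℝ}
    (hB : ∀ n, dist (u n) (v n) ≤ B) : GromovAsymptotic u v := by
  refine (gromovAsymptotic_iff (u 0)).2 fun r => ?_
  obtain ⟨N, hN⟩ := (gromovAsymptotic_iff (u 0)).1 h (r + B)
  refine ⟨N, fun n m hn hm => ?_⟩
  have h1 := hN n m hn hm
  have h2 := gromovProduct_le_add_dist_left (u 0) (u m) (v m) (u n)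
  rw [gromovProduct_comm _ (u m), gromovProduct_comm _ (v m)] at h2
  linarith [hB m]

/-- If `w k` is joined to terms of a Gromov sequence `v` of arbitrarily large index by Gromov
products at least `k - B`, then `w` and `v` are asymptotic. -/
theorem gromovAsymptotic_of_eventually_le {δ : ℝ} (hX : IsDeltaHyperbolic δ X) {v w : ℕ → X}
    (hv : GromovAsymptotic v v) {U : Filter ℕ} [U.NeBot] (hU : U ≤ atTop) (x : X) {B : ℝ}
    (h : ∀ k : ℕ, ∀ᶠ n in U, (k : ℝ) - B ≤ gromovProduct x (w k) (v n)) :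
    GromovAsymptotic w v := by
  refine (gromovAsymptotic_iff x).2 fun r => ?_
  obtain ⟨N, hN⟩ := (gromovAsymptotic_iff x).1 hv (r + δ)
  obtain ⟨N', hN'⟩ := exists_nat_ge (r + δ + B)
  refine ⟨max N N', fun k m hk hm => ?_⟩
  obtain ⟨n, hn, hnN⟩ := ((h k).and (hU (eventually_ge_atTop N))).exists
  have hk' : (N' : ℝ) ≤ k := by exact_mod_cast (le_max_right _ _).trans hk
  have := hX.le_gromovProduct (r := r + δ) (by linarith) (hN n m hnN ((le_max_left _ _).trans hm))
  linarith

end GromovProduct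

/-! ### Convergence to boundary points -/

section Boundary

variable {X : Type*} [MetricSpace X]

theorem GromovBoundary.exists_convergesToBoundary (z : GromovBoundary X) :
    ∃ u : ℕ → X, ConvergesToBoundary u z := by
  induction z using Quot.ind with
  | mk u => exact ⟨u.1, u.2, rfl⟩

theorem ConvergesToBoundary.gromovAsymptotic {δ : ℝ} (hX : IsDeltaHyperbolic δ X) {u v : ℕ → X}
    {z : GromovBoundary X} (hu : ConvergesToBoundary u z) (hv : ConvergesToBoundary v z) :
    GromovAsymptotic u v := by
  obtain ⟨hu, rfl⟩ := hu
  obtain ⟨hv, h⟩ := hv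
  exact ((GromovBoundary.mk_eq_mk_iff hX _ _).1 h).symm

theorem ConvergesToBoundary.of_gromovAsymptotic {δ : ℝ} (hX : IsDeltaHyperbolic δ X)
    {u v : ℕ → X} {z : GromovBoundary X} (hu : ConvergesToBoundary u z)
    (h : GromovAsymptotic u v) : ConvergesToBoundary v z := by
  obtain ⟨hu, rfl⟩ := hu
  exact ⟨h.symm.trans hX h, (GromovBoundary.mk_eq_mk_iff hX _ _).2 h.symm⟩

theorem ConvergesToBoundary.map (g : X ≃ᵢ X) {u : ℕ → X} {z : GromovBoundary X}
    (hu : ConvergesToBoundary u z) : ConvergesToBoundary (fun n => g (u n)) (boundaryMap g z) := by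
  obtain ⟨hu, rfl⟩ := hu
  exact ⟨hu.map g, rfl⟩

theorem boundaryMap_apply_inv (g : X ≃ᵢ X) (z : GromovBoundary X) :
    boundaryMap g (boundaryMap g⁻¹ z) = z := by
  induction z using Quot.ind with
  | mk u =>
    refine congrArg (Quot.mk _) (Subtype.ext (funext fun n => ?_))
    exact g.apply_symm_apply (u.1 n)

theorem boundaryMap_mem_limitSet {Γ : Subgroup (X ≃ᵢ X)} {g : X ≃ᵢ X} (hg : g ∈ Γ)
    {z : GromovBoundary X} (hz : z ∈ limitSet Γ) : boundaryMap g z ∈ limitSet Γ := by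
  obtain ⟨x, h, hh⟩ := hz
  refine ⟨x, fun n => ⟨g, hg⟩ * h n, ?_⟩
  have := hh.map g
  simpa only [Subgroup.coe_mul, IsometryEquiv.mul_apply] using this

/-- The limit set does not depend on the orbit chosen to define it. -/
theorem exists_orbit_convergesToBoundary {δ : ℝ} (hX : IsDeltaHyperbolic δ X)
    {Γ : Subgroup (X ≃ᵢ X)} {z : GromovBoundary X} (hz : z ∈ limitSet Γ) (x : X) :
    ∃ g : ℕ → Γ, ConvergesToBoundary (fun n => (g n : X ≃ᵢ X) x) z := by
  obtain ⟨y, g, hg⟩ := hz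
  refine ⟨g, hg.of_gromovAsymptotic hX (hg.1.of_dist_le (B := dist y x) fun n => ?_)⟩
  exact (IsometryEquiv.dist_eq _ _ _).le

theorem le_boundaryGromovProduct {x : X} {u v : ℕ → X} {z w : GromovBoundary X}
    (hu : ConvergesToBoundary u z) (hv : ConvergesToBoundary v w) {r : ℝ}
    (h : ∀ᶠ p : ℕ × ℕ in atTop, r ≤ gromovProduct x (u p.1) (v p.2)) :
    (r : EReal) ≤ boundaryGromovProduct x z w := by
  refine le_trans (le_liminf_of_le (by isBoundedDefault) (h.mono fun p hp => ?_))
    (le_iSup₂_of_le u v (le_iSup₂_of_le hu hv le_rfl))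
  exact EReal.coe_le_coe_iff.2 hp

/-- In a hyperbolic space every choice of representing sequences computes the Gromov product of two
boundary points up to `2δ`. -/
theorem eventually_le_gromovProduct {δ : ℝ} (hX : IsDeltaHyperbolic δ X) {x : X} {u v : ℕ → X}
    {z w : GromovBoundary X} (hu : ConvergesToBoundary u z) (hv : ConvergesToBoundary v w) {r : ℝ}
    (h : (r : EReal) < boundaryGromovProduct x z w) :
    ∀ᶠ p : ℕ × ℕ in atTop, r - 2 * δ ≤ gromovProduct x (u p.1) (v p.2) := by
  simp only [boundaryGromovProduct, lt_iSup_iff] at h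
  obtain ⟨u', v', hu', hv', h⟩ := h
  obtain ⟨N, hN⟩ := eventually_atTop_prod_self.1 (eventually_lt_of_lt_liminf h)
  obtain ⟨N1, h1⟩ := (gromovAsymptotic_iff x).1 (hu.gromovAsymptotic hX hu') r
  obtain ⟨N2, h2⟩ := (gromovAsymptotic_iff x).1 (hv'.gromovAsymptotic hX hv) (r - δ)
  refine eventually_atTop_prod_self.2 ⟨max N1 N2, fun n m hn hm => ?_⟩
  set k := max N (max N1 N2)
  have hkN : N ≤ k := le_max_left _ _
  have hk : max N1 N2 ≤ k := le_max_right _ _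
  have e1 := h1 n k ((le_max_left _ _).trans hn) ((le_max_left _ _).trans hk)
  have e2 : r ≤ gromovProduct x (u' k) (v' k) :=
    (EReal.coe_lt_coe_iff.1 (hN k k hkN hkN)).le
  have e3 := hX.le_gromovProduct e1 e2
  have e4 := h2 k m ((le_max_right _ _).trans hk) ((le_max_right _ _).trans hm)
  have e5 := hX.le_gromovProduct e3 e4
  dsimp only
  linarith

end Boundary

/-! ### Standard visual metrics -/

section VisualMetric

variable {X : Type*} [MetricSpace X] [MetricSpace (GromovBoundary X)] {δ a : ℝ} {x : X}

theorem IsStandardVisualMetric.dist_le (hD : IsStandardVisualMetric δ a x) {u v : ℕ → X}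
    {z w : GromovBoundary X} (hu : ConvergesToBoundary u z) (hv : ConvergesToBoundary v w) {r : ℝ}
    (h : ∀ᶠ p : ℕ × ℕ in atTop, r ≤ gromovProduct x (u p.1) (v p.2)) :
    dist z w ≤ Real.exp (-(a * r)) := by
  have h1 := le_boundaryGromovProduct hu hv h
  rw [← ENNReal.ofReal_le_ofReal_iff (Real.exp_pos _).le, ← edist_dist]
  refine (hD.2.2 z w).2.trans ?_
  rw [← EReal.exp_coe, EReal.coe_neg, EReal.coe_mul]
  have ha : (0 : EReal) ≤ a := EReal.coe_nonneg.2 hD.1.le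
  exact EReal.exp_monotone (EReal.neg_le_neg_iff.2 (mul_le_mul_of_nonneg_left h1 ha))

theorem IsStandardVisualMetric.eventually_le_gromovProduct (hD : IsStandardVisualMetric δ a x)
    (hX : IsDeltaHyperbolic δ X) {u v : ℕ → X} {z w : GromovBoundary X}
    (hu : ConvergesToBoundary u z) (hv : ConvergesToBoundary v w) {r : ℝ}
    (h : dist z w < (3 - 2 * Real.exp (a * δ)) * Real.exp (-(a * r))) :
    ∀ᶠ p : ℕ × ℕ in atTop, r - 2 * δ ≤ gromovProduct x (u p.1) (v p.2) := by
  refine _root_.eventually_le_gromovProduct hX hu hv ?_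
  by_contra! h1
  refine h.not_ge ?_
  rw [← ENNReal.ofReal_le_ofReal_iff dist_nonneg, ← edist_dist]
  refine le_trans ?_ (hD.2.2 z w).1
  rw [ENNReal.ofReal_mul' (Real.exp_pos _).le, ← EReal.exp_coe, EReal.coe_neg, EReal.coe_mul]
  have ha : (0 : EReal) ≤ a := EReal.coe_nonneg.2 hD.1.le
  gcongr
  exact EReal.neg_le_neg_iff.2 (mul_le_mul_of_nonneg_left h1 ha)

/-- An additive comparison of Gromov products turns into a multiplicative comparison of visual
distances. -/
theorem IsStandardVisualMetric.dist_le_mul_dist (hD : IsStandardVisualMetric δ a x)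
    (hX : IsDeltaHyperbolic δ X) (hc : 0 < 3 - 2 * Real.exp (a * δ)) {u v u' v' : ℕ → X}
    {z w z' w' : GromovBoundary X} (hu : ConvergesToBoundary u z) (hv : ConvergesToBoundary v w)
    (hu' : ConvergesToBoundary u' z') (hv' : ConvergesToBoundary v' w') {K : ℝ}
    (h : ∀ᶠ p : ℕ × ℕ in atTop,
      gromovProduct x (u p.1) (v p.2) ≤ gromovProduct x (u' p.1) (v' p.2) + K) :
    dist z' w' ≤ Real.exp (a * (K + 2 * δ)) / (3 - 2 * Real.exp (a * δ)) * dist z w := by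
  set c := 3 - 2 * Real.exp (a * δ) with hcdef
  have ha := hD.1
  suffices H : ∀ s, dist z w < s → dist z' w' / (Real.exp (a * (K + 2 * δ)) / c) ≤ s by
    have := le_of_forall_gt_imp_ge_of_dense H
    rwa [div_le_iff₀' (by positivity)] at this
  intro s hs
  have hs0 : 0 < s := dist_nonneg.trans_lt hs
  -- `r` is chosen so that `c * exp (-(a * r)) = s`.
  obtain ⟨r, hr⟩ : ∃ r, c * Real.exp (-(a * r)) = s := by
    refine ⟨-(Real.log (s / c) / a), ?_⟩
    rw [mul_neg, neg_neg, mul_div_cancel₀ _ ha.ne', Real.exp_log (by positivity)]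
    field_simp
  have h1 := hD.eventually_le_gromovProduct hX hu hv (r := r) (by rw [← hcdef, hr]; exact hs)
  have h2 := hD.dist_le hu' hv' (r := r - 2 * δ - K)
    ((h.and h1).mono fun p hp => by linarith [hp.1, hp.2])
  rw [div_le_iff₀' (by positivity), ← hr]
  refine h2.trans_eq ?_
  rw [div_mul_eq_mul_div, mul_left_comm, ← Real.exp_add, mul_div_cancel_left₀ _ hc.ne']
  ring_nf

end VisualMetric

/-! ### Geodesic lines -/

section Lines

variable {X : Type*} [MetricSpace X]

/-- A chain of points from `u` to `v` with steps of length `ε`, read as a function of the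
real parameter: `f s` is at distance about `s` from `u`, and all points of the chain lie in
order. -/
theorem IsGeodesicSpace.exists_chain (hX : IsGeodesicSpace X) (u v : X) {ε : ℝ} (hε : 0 < ε) :
    ∃ f : ℝ → X, ∀ s ∈ Icc 0 (dist u v),
      |dist u (f s) - s| ≤ ε ∧ dist u (f s) + dist (f s) v = dist u v ∧
        ∀ t, dist (f s) (f t) = |dist u (f s) - dist u (f t)| := by
  have hstep : ∀ p : X, ∃ q : X, dist p q = min ε (dist p v) ∧
      dist q v = dist p v - min ε (dist p v) := fun p =>
    hX p v _ ⟨le_min hε.le dist_nonneg, min_le_right _ _⟩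
  choose q hq1 hq2 using hstep
  set p : ℕ → X := fun k => q^[k] u with hp
  have hp0 : p 0 = u := rfl
  have hps : ∀ k, p (k + 1) = q (p k) := fun k => Function.iterate_succ_apply' _ _ _
  have hv : ∀ k : ℕ, dist (p k) v = max (dist u v - k * ε) 0 := by
    intro k
    induction k with
    | zero => simp [hp0]
    | succ k ih =>
      rw [hps, hq2, ih]
      push_cast
      rcases le_total (dist u v - k * ε) 0 with h | h
      · rw [max_eq_right h, min_eq_right hε.le, max_eq_right (by linarith)]
        simp
      · rw [max_eq_left h]
        rcases le_total ε (dist u v - k * ε) with h' | h'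
        · rw [min_eq_left h', max_eq_left (by linarith)]
          ring
        · rw [min_eq_right h', max_eq_right (by linarith)]
          ring
  have hle : ∀ i j : ℕ, dist (p i) (p (i + j)) = dist (p i) v - dist (p (i + j)) v := by
    intro i j
    refine le_antisymm ?_ (by linarith [dist_triangle (p i) (p (i + j)) v])
    induction j with
    | zero => simp
    | succ j ih =>
      have h1 := hq1 (p (i + j))
      have h2 := hq2 (p (i + j))
      rw [← hps] at h1 h2
      have h3 := dist_triangle (p i) (p (i + j)) (p (i + j + 1))
      rw [← add_assoc]
      linarith
  have hu : ∀ k, dist u (p k) = dist u v - dist (p k) v := fun k => by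
    simpa [hp0] using hle 0 k
  have hd : ∀ i j : ℕ, dist (p i) (p j) = |dist u (p i) - dist u (p j)| := by
    intro i j
    wlog hij : i ≤ j generalizing i j
    · rw [dist_comm, abs_sub_comm]
      exact this j i (le_of_not_ge hij)
    obtain ⟨k, rfl⟩ := Nat.exists_eq_add_of_le hij
    rw [abs_sub_comm, hu, hu, abs_of_nonneg, hle]
    · ring
    · linarith [hle i k, dist_nonneg (x := p i) (y := p (i + k))]
  refine ⟨fun s => p ⌊s / ε⌋₊, fun s hs => ⟨?_, by rw [hu]; ring, fun t => hd _ _⟩⟩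
  have h1 := Nat.floor_le (div_nonneg hs.1 hε.le)
  have h2 := (Nat.lt_floor_add_one (s / ε)).le
  rw [le_div_iff₀ hε] at h1
  rw [div_le_iff₀ hε] at h2
  rw [hu, hv, max_eq_left (by linarith [hs.2]), abs_le]
  constructor <;> linarith

/-- Two sequences converging to boundary points, whose Gromov products based at `x` do not tend to
infinity, are joined by chains passing at bounded distance from `x`. An ultrafilter limit of these
chains is a geodesic line that joins the two boundary points and passes near `x`. -/
theorem exists_isometry_line {δ : ℝ} [ProperSpace X] (hG : IsGeodesicSpace X)
    (hX : IsDeltaHyperbolic δ X) (x : X) {u v : ℕ → X} {z w : GromovBoundary X}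
    (hu : ConvergesToBoundary u z) (hv : ConvergesToBoundary v w) {K : ℝ}
    (hK : ∃ᶠ n in atTop, gromovProduct x (u n) (v n) ≤ K) :
    ∃ γ : ℝ → X, Isometry γ ∧ ConvergesToBoundary (fun n : ℕ => γ n) w ∧
      ConvergesToBoundary (fun n : ℕ => γ (-(n : ℝ))) z ∧
      dist x (γ 0) ≤ K + 2 * δ + 1 := by
  choose f hf using fun n : ℕ =>
    hG.exists_chain (u n) (v n) (Nat.one_div_pos_of_nat (α := ℝ) (n := n))
  set S := {n | gromovProduct x (u n) (v n) ≤ K}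
  have : (atTop ⊓ 𝓟 S).NeBot := frequently_iff_neBot.1 hK
  set U := Ultrafilter.of (atTop ⊓ 𝓟 S)
  have hU : (U : Filter ℕ) ≤ atTop := (Ultrafilter.of_le _).trans inf_le_left
  have hUS : ∀ᶠ n in U, gromovProduct x (u n) (v n) ≤ K :=
    (Ultrafilter.of_le _).trans inf_le_right (mem_principal_self S)
  have hε : Tendsto (fun n : ℕ => 1 / ((n : ℝ) + 1)) U (nhds 0) :=
    tendsto_one_div_add_atTop_nhds_zero_nat.mono_left hU
  have hε1 : ∀ n : ℕ, 1 / ((n : ℝ) + 1) ≤ 1 := fun n =>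
    (div_le_one (by positivity)).2 (by linarith [Nat.cast_nonneg (α := ℝ) n])
  -- Both ends of the chains are far from the internal points of the triangles `x, u n, v n`.
  set A : ℕ → ℝ := fun n => gromovProduct (u n) x (v n) with hA
  have hAB : ∀ n, A n + gromovProduct (v n) x (u n) = dist (u n) (v n) := fun n => by
    have := gromovProduct_add_gromovProduct (u n) (v n) x
    rwa [gromovProduct_comm (u n), gromovProduct_comm (v n)] at this
  have hfar : ∀ s : ℕ → X, GromovAsymptotic s s →
      ∀ R, ∀ᶠ n in (U : Filter ℕ), R ≤ dist x (s n) := by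
    intro s hs R
    obtain ⟨N, hN⟩ := (gromovAsymptotic_iff x).1 hs R
    filter_upwards [hU (eventually_ge_atTop N)] with n hn
    rw [← gromovProduct_self]
    exact hN n n hn hn
  have hA1 : ∀ R, ∀ᶠ n in (U : Filter ℕ), R ≤ A n := fun R => by
    filter_upwards [hfar u hu.1 (R + K), hUS] with n h1 h2
    have := gromovProduct_add_gromovProduct x (u n) (v n)
    simp only [hA]
    linarith
  have hA2 : ∀ R, ∀ᶠ n in (U : Filter ℕ), R ≤ dist (u n) (v n) - A n := fun R => by
    filter_upwards [hfar v hv.1 (R + K), hUS] with n h1 h2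
    have := gromovProduct_add_gromovProduct x (v n) (u n)
    rw [gromovProduct_comm x] at this
    linarith [hAB n]
  have hIcc : ∀ t : ℝ, ∀ᶠ n in (U : Filter ℕ), t + A n ∈ Icc 0 (dist (u n) (v n)) := fun t => by
    filter_upwards [hA1 (-t), hA2 t] with n h1 h2
    exact ⟨by linarith, by linarith⟩
  -- The chains `c n`, with parameter `0` near the internal points, and the exact position `h t n`
  -- of `c n t` along the chain.
  set c : ℕ → ℝ → X := fun n t => f n (t + A n) with hc
  set h : ℝ → ℕ → ℝ := fun t n => dist (u n) (c n t) - A n with hh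
  have hht : ∀ t, Tendsto (h t) U (nhds t) := fun t => by
    refine tendsto_iff_dist_tendsto_zero.2 (squeeze_zero'
      (Eventually.of_forall fun _ => dist_nonneg) ((hIcc t).mono fun n hn => ?_) hε)
    rw [Real.dist_eq, hh, sub_sub, add_comm (A n)]
    exact (hf n _ hn).1
  have hdist : ∀ s t, ∀ᶠ n in (U : Filter ℕ), dist (c n s) (c n t) = |h s n - h t n| := by
    intro s t
    filter_upwards [hIcc s] with n hn
    rw [(hf n _ hn).2.2 (t + A n)]
    simp only [hh, hc]
    congr 1
    ring
  have hdist' : ∀ s t, Tendsto (fun n => dist (c n s) (c n t)) U (nhds |s - t|) := fun s t =>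
    (((hht s).sub (hht t)).abs).congr' ((hdist s t).mono fun n hn => hn.symm)
  have h0 : ∀ᶠ n in (U : Filter ℕ), dist x (c n 0) ≤ K + 2 * δ + 1 := by
    filter_upwards [hIcc 0, hUS] with n hn hn'
    obtain ⟨h1, h2, -⟩ := hf n _ hn
    have h1' := abs_le.1 h1
    have h3 := hAB n
    have := hX.dist_internal_point_le (x := x) (u := u n) (v := v n) (p := c n 0)
      (ε := 1 / ((n : ℝ) + 1)) (by simp only [hc]; linarith [h1'.2])
      (by simp only [hc]; linarith [h1'.1])
    linarith [hε1 n]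
  have hlim : ∀ t, ∃ p, Tendsto (fun n => c n t) U (nhds p) := fun t => by
    have hmem : ∀ᶠ n in (U : Filter ℕ),
        c n t ∈ Metric.closedBall x (K + 2 * δ + 1 + (|t| + 1)) := by
      have h2 := hdist' t 0
      rw [sub_zero] at h2
      filter_upwards [h0, h2.eventually_le_const (lt_add_one _)] with n hn hn'
      rw [Metric.mem_closedBall]
      linarith [dist_triangle_right (c n t) x (c n 0)]
    obtain ⟨p, -, hp⟩ := (isCompact_closedBall x (K + 2 * δ + 1 + (|t| + 1))).ultrafilter_le_nhds
      (U.map fun n => c n t) (le_principal_iff.2 hmem)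
    exact ⟨p, hp⟩
  choose γ hγ using hlim
  have hiso : Isometry γ := Isometry.of_dist_eq fun s t => by
    rw [Real.dist_eq]
    exact tendsto_nhds_unique ((hγ s).dist (hγ t)) (hdist' s t)
  have hnear : ∀ t, ∀ᶠ n in (U : Filter ℕ), dist (γ t) (c n t) ≤ 1 := fun t => by
    have := (tendsto_const_nhds (x := γ t)).dist (hγ t)
    rw [dist_self] at this
    exact this.eventually_le_const one_pos
  refine ⟨γ, hiso, hv.of_gromovAsymptotic hX ?_, hu.of_gromovAsymptotic hX ?_, ?_⟩
  · refine (gromovAsymptotic_of_eventually_le hX hv.1 hU x (B := K + 2 * δ + 3) fun k => ?_).symm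
    filter_upwards [h0, hnear k, hdist 0 k, hIcc 0, hIcc k,
      ((hht k).sub (hht 0)).eventually_const_le (sub_one_lt _)] with n e0 e1 e2 e3 e4 e5
    have d0 := (hf n _ e3).2.1
    have d1 := (hf n _ e4).2.1
    have i1 := gromovProduct_le_add_dist_left x (c n k) (γ k) (v n)
    have i2 := gromovProduct_le_add_dist_base (c n 0) x (c n k) (v n)
    rw [dist_comm] at i1
    rw [dist_comm (c n 0) x] at i2
    have i3 : h k n - h 0 n ≤ gromovProduct (c n 0) (c n k) (v n) := by
      have := neg_abs_le (h 0 n - h k n)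
      simp only [gromovProduct, e2]
      simp only [hh, hc] at d0 d1 this ⊢
      linarith
    linarith
  · refine (gromovAsymptotic_of_eventually_le hX hu.1 hU x (B := K + 2 * δ + 3) fun k => ?_).symm
    filter_upwards [h0, hnear (-k), hdist 0 (-k),
      ((hht 0).sub (hht (-k))).eventually_const_le (sub_one_lt _)] with n e0 e1 e2 e5
    have i1 := gromovProduct_le_add_dist_left x (c n (-k)) (γ (-k)) (u n)
    have i2 := gromovProduct_le_add_dist_base (c n 0) x (c n (-k)) (u n)
    rw [dist_comm] at i1
    rw [dist_comm (c n 0) x] at i2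
    have i3 : h 0 n - h (-k) n ≤ gromovProduct (c n 0) (c n (-k)) (u n) := by
      have := le_abs_self (h 0 n - h (-k) n)
      simp only [gromovProduct, e2, dist_comm _ (u n)]
      simp only [hh, hc] at this ⊢
      linarith
    linarith
  · exact le_of_tendsto ((tendsto_const_nhds (x := x)).dist (hγ 0)) h0

/-- Every point `z` of `C` is the endpoint of a geodesic line of the quasiconvex hull of `C` that
passes within a uniform distance of a given point of the hull. By hyperbolicity, `z` and one of the
two endpoints of a line through that point have a small Gromov product. -/
theorem exists_line_of_mem_quasiconvexHull {δ : ℝ} [ProperSpace X] (hG : IsGeodesicSpace X)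
    (hX : IsDeltaHyperbolic δ X) {C : Set (GromovBoundary X)} {x : X}
    (hx : x ∈ quasiconvexHull C) {z : GromovBoundary X} (hz : z ∈ C) :
    ∃ γ : ℝ → X, Isometry γ ∧ (∀ t, γ t ∈ quasiconvexHull C) ∧
      ConvergesToBoundary (fun n : ℕ => γ n) z ∧ dist x (γ 0) ≤ 3 * δ + 1 := by
  obtain ⟨σ, hσ, ⟨a, ha, hσa⟩, ⟨b, hb, hσb⟩, s, rfl⟩ := hx
  obtain ⟨t, ht⟩ := z.exists_convergesToBoundary
  have key : ∀ᶠ n : ℕ in atTop, gromovProduct (σ s) (σ n) (t n) ≤ δ ∨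
      gromovProduct (σ s) (σ (-(n : ℝ))) (t n) ≤ δ := by
    obtain ⟨N, hN⟩ := exists_nat_ge |s|
    refine (eventually_ge_atTop N).mono fun n hn => ?_
    have hn' : |s| ≤ n := hN.trans (by exact_mod_cast hn)
    have h0 : gromovProduct (σ s) (σ n) (σ (-(n : ℝ))) = 0 := by
      have := abs_le.1 hn'
      simp only [gromovProduct, hσ.dist_eq, Real.dist_eq]
      rw [abs_of_nonpos (by linarith), abs_of_nonneg (by linarith), abs_of_nonneg (by linarith)]
      ring
    have h1 := hX (σ n) (t n) (σ (-(n : ℝ))) (σ s)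
    rw [h0, gromovProduct_comm _ (t n) (σ (-(n : ℝ))), sub_nonpos] at h1
    exact min_le_iff.1 h1
  have finish : ∀ (u : ℕ → X) (c : GromovBoundary X), c ∈ C → ConvergesToBoundary u c →
      (∃ᶠ n in atTop, gromovProduct (σ s) (u n) (t n) ≤ δ) →
      ∃ γ : ℝ → X, Isometry γ ∧ (∀ t, γ t ∈ quasiconvexHull C) ∧
        ConvergesToBoundary (fun n : ℕ => γ n) z ∧ dist (σ s) (γ 0) ≤ 3 * δ + 1 := by
    intro u c hcC hu hfr
    obtain ⟨γ, hγ, h1, h2, h3⟩ := exists_isometry_line hG hX (σ s) hu ht hfr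
    exact ⟨γ, hγ, fun r => ⟨γ, hγ, ⟨z, hz, h1⟩, ⟨c, hcC, h2⟩, r, rfl⟩, h1, by linarith⟩
  rcases frequently_or_distrib.1 key.frequently with h | h
  · exact finish _ a ha hσa h
  · exact finish _ b hb hσb h

end Lines

/-! ### Compactness of the limit set -/

section Compactness

variable {X : Type*} [MetricSpace X] [MetricSpace (GromovBoundary X)] {δ a : ℝ} {x : X}

theorem exists_exp_neg_mul_lt (ha : 0 < a) {ε : ℝ} (hε : 0 < ε) (b : ℝ) :
    ∃ R : ℝ, b ≤ R ∧ Real.exp (-(a * R)) < ε := by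
  have h1 : Tendsto (fun R : ℝ => Real.exp (-(a * R))) atTop (nhds 0) :=
    Real.tendsto_exp_neg_atTop_nhds_zero.comp (tendsto_id.const_mul_atTop ha)
  exact ((eventually_ge_atTop b).and (h1.eventually_lt_const hε)).exists

/-- Boundary points are told apart, up to `ε`, by the points at a fixed large distance from `x` on
geodesics towards them, and closed balls of `X` are compact. -/
theorem IsStandardVisualMetric.totallyBounded [ProperSpace X] (hG : IsGeodesicSpace X)
    (hX : IsDeltaHyperbolic δ X) (hD : IsStandardVisualMetric δ a x)
    (s : Set (GromovBoundary X)) : TotallyBounded s := by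
  refine Metric.totallyBounded_of_finite_discretization fun ε hε => ?_
  have hδ := hX.nonneg x
  obtain ⟨R', hR'0, hR⟩ := exists_exp_neg_mul_lt hD.1 hε 0
  set R := R' + 1 + 3 * δ with hRdef
  have hR0 : 0 ≤ R := by positivity
  have hrep : ∀ z : GromovBoundary X, ∃ (u : ℕ → X) (p : X), ConvergesToBoundary u z ∧
      dist x p = R ∧ ∃ N, ∀ n, N ≤ n → R - δ ≤ gromovProduct x (u n) p := by
    intro z
    obtain ⟨u, hu⟩ := z.exists_convergesToBoundary
    obtain ⟨N, hN⟩ := (gromovAsymptotic_iff x).1 hu.1 R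
    have hNN := hN N N le_rfl le_rfl
    rw [gromovProduct_self] at hNN
    obtain ⟨p, hp1, hp2⟩ := hG x (u N) R ⟨hR0, hNN⟩
    refine ⟨u, p, hu, hp1, N, fun n hn => hX.le_gromovProduct (hN n N hn le_rfl) (le_of_eq ?_)⟩
    rw [gromovProduct, dist_comm (u N) p, hp1, hp2]
    ring
  choose u p hu hp N hN using hrep
  have hcomp := (isCompact_closedBall x R).totallyBounded
  obtain ⟨t, ht, hcov⟩ := Metric.totallyBounded_iff.1 hcomp (1 / 2) (by norm_num)
  have hcl : ∀ z : GromovBoundary X, ∃ q ∈ t, dist (p z) q < 1 / 2 := fun z => by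
    have h1 : p z ∈ Metric.closedBall x R := by
      rw [Metric.mem_closedBall, dist_comm, hp]
    simpa using hcov h1
  choose q hqt hq using hcl
  have := ht.fintype
  refine ⟨t, ht.fintype, fun z => ⟨q z, hqt z⟩, fun z w hzw => lt_of_le_of_lt ?_ hR⟩
  have hqq : q z = q w := congrArg Subtype.val hzw
  have hpp : dist (p z) (p w) ≤ 1 := by
    have h1 := hq z
    have h2 := hq w
    rw [hqq] at h1
    linarith [dist_triangle_right (p z) (p w) (q w)]
  have hpp' : R - 1 / 2 ≤ gromovProduct x (p z) (p w) := by
    rw [gromovProduct, hp, hp]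
    linarith
  refine hD.dist_le (hu z) (hu w) (eventually_atTop_prod_self.2 ⟨max (N z) (N w), ?_⟩)
  intro n m hn hm
  have e1 := hN z n ((le_max_left _ _).trans hn)
  have e2 := hN w m ((le_max_right _ _).trans hm)
  rw [gromovProduct_comm] at e2
  have e3 := hX.le_gromovProduct (r := R' + 2 * δ) (by linarith) (hpp'.trans' (by linarith))
  have e4 := hX.le_gromovProduct (r := R' + δ) (e3.trans' (by linarith)) (e2.trans' (by linarith))
  dsimp only
  linarith

/-- A Cauchy sequence `z n` of limit points is shadowed by orbit points `y n` with
`(y n, z n)_x ≥ n`; these form a Gromov sequence, whose class is the limit. -/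
theorem IsStandardVisualMetric.completeSpace_limitSet (hX : IsDeltaHyperbolic δ X)
    (hc : 0 < 3 - 2 * Real.exp (a * δ)) (hD : IsStandardVisualMetric δ a x)
    (Γ : Subgroup (X ≃ᵢ X)) : CompleteSpace (limitSet Γ) := by
  refine Metric.complete_of_cauchySeq_tendsto fun z hz => ?_
  choose g hg using fun n : ℕ => exists_orbit_convergesToBoundary hX (z n).2 x
  -- All later terms of the orbit sequence of `z n` have Gromov product
  -- at least `n` with term `k n`.
  have hk : ∀ n : ℕ, ∃ k : ℕ, ∀ i, k ≤ i →
      (n : ℝ) ≤ gromovProduct x ((g n k : X ≃ᵢ X) x) ((g n i : X ≃ᵢ X) x) := fun n => by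
    obtain ⟨N, hN⟩ := (gromovAsymptotic_iff x).1 (hg n).1 n
    exact ⟨N, fun i hi => hN N i le_rfl hi⟩
  choose k hk using hk
  set y : ℕ → X := fun n => (g n (k n) : X ≃ᵢ X) x with hy
  have hyg : GromovAsymptotic y y := by
    refine (gromovAsymptotic_iff x).2 fun r => ?_
    obtain ⟨N, hN⟩ := Metric.cauchySeq_iff.1 hz
      ((3 - 2 * Real.exp (a * δ)) * Real.exp (-(a * (r + 4 * δ)))) (by positivity)
    obtain ⟨N', hN'⟩ := exists_nat_ge (r + 2 * δ)
    refine ⟨max N N', fun n m hn hm => ?_⟩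
    have h1 : dist (z n : GromovBoundary X) (z m) < _ :=
      hN n ((le_max_left _ _).trans hn) m ((le_max_left _ _).trans hm)
    obtain ⟨M, hM⟩ := eventually_atTop_prod_self.1
      (hD.eventually_le_gromovProduct hX (hg n) (hg m) h1)
    set i := max M (max (k n) (k m))
    have i1 : M ≤ i := le_max_left _ _
    have i2 : k n ≤ i := (le_max_left _ _).trans (le_max_right _ _)
    have i3 : k m ≤ i := (le_max_right _ _).trans (le_max_right _ _)
    have n1 : (N' : ℝ) ≤ n := by exact_mod_cast (le_max_right _ _).trans hn
    have n2 : (N' : ℝ) ≤ m := by exact_mod_cast (le_max_right _ _).trans hm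
    have e1 := hk n i i2
    have e2 := hk m i i3
    have e3 := hM i i i1 i1
    rw [gromovProduct_comm] at e2
    have hδ := hX.nonneg x
    have e4 := hX.le_gromovProduct (r := r + 2 * δ) (by linarith) (e3.trans' (by linarith))
    have e5 := hX.le_gromovProduct (r := r + δ) (e4.trans' (by linarith)) (e2.trans' (by linarith))
    linarith
  have hlim : GromovBoundary.mk ⟨y, hyg⟩ ∈ limitSet Γ := ⟨x, fun n => g n (k n), hyg, rfl⟩
  refine ⟨⟨_, hlim⟩, tendsto_iff_dist_tendsto_zero.2 ?_⟩
  have hyc : ConvergesToBoundary y (GromovBoundary.mk ⟨y, hyg⟩) := ⟨hyg, rfl⟩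
  refine Metric.tendsto_atTop.2 fun ε hε => ?_
  obtain ⟨R, -, hR⟩ := exists_exp_neg_mul_lt hD.1 hε 0
  obtain ⟨N, hN⟩ := (gromovAsymptotic_iff x).1 hyg (R + δ)
  obtain ⟨N', hN'⟩ := exists_nat_ge (R + δ)
  refine ⟨max N N', fun n hn => ?_⟩
  rw [Real.dist_0_eq_abs, abs_of_nonneg dist_nonneg]
  refine lt_of_le_of_lt (hD.dist_le (hg n) hyc (eventually_atTop_prod_self.2
    ⟨max N (k n), fun i m hi hm => ?_⟩)) hR
  have n1 : (N' : ℝ) ≤ n := by exact_mod_cast (le_max_right _ _).trans hn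
  have e1 := hk n i ((le_max_right _ _).trans hi)
  rw [gromovProduct_comm] at e1
  have e2 := hN n m ((le_max_left _ _).trans hn) ((le_max_left _ _).trans hm)
  have e3 := hX.le_gromovProduct (r := R + δ) (by linarith) e2
  dsimp only
  linarith

theorem IsStandardVisualMetric.compactSpace_limitSet [ProperSpace X] (hG : IsGeodesicSpace X)
    (hX : IsDeltaHyperbolic δ X) (hc : 0 < 3 - 2 * Real.exp (a * δ))
    (hD : IsStandardVisualMetric δ a x) (Γ : Subgroup (X ≃ᵢ X)) : CompactSpace (limitSet Γ) := by
  have := hD.completeSpace_limitSet hX hc Γ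
  exact isCompact_iff_compactSpace.1 (isCompact_iff_totallyBounded_isComplete.2
    ⟨hD.totallyBounded hG hX _, completeSpace_coe_iff_isComplete.1 this⟩)

end Compactness

/-! ### Rescaling by group elements -/

section Rescaling

theorem visualParameter_pos {δ : ℝ} (hδ : 0 < δ) : 0 < visualParameter δ := by
  have : 0 < Real.logb 2 (Real.exp 1) := Real.logb_pos one_lt_two (Real.one_lt_exp_iff.2 one_pos)
  unfold visualParameter
  positivity

theorem visualParameter_mul {δ : ℝ} (hδ : 0 < δ) : visualParameter δ * δ = Real.log 2 / 4 := by
  have := Real.log_pos one_lt_two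
  rw [visualParameter, Real.logb, Real.log_exp]
  field_simp

theorem visualParameter_const_pos {δ : ℝ} (hδ : 0 < δ) :
    0 < 3 - 2 * Real.exp (visualParameter δ * δ) := by
  have h : Real.exp (visualParameter δ * δ) < 3 / 2 := by
    rw [← Real.lt_log_iff_exp_lt (by norm_num), visualParameter_mul hδ]
    have h1 : Real.log 2 < Real.log ((3 / 2) ^ 4) := Real.log_lt_log (by norm_num) (by norm_num)
    rw [Real.log_pow] at h1
    push_cast at h1
    linarith
  linarith

variable {X : Type*} [MetricSpace X] {δ : ℝ}

/-- For a point `y` at distance about `T` from `x` in the direction of the sequences `u` and `v`,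
moving the base point from `x` to `y` lowers `(u, v)` by about `T`. -/
theorem IsDeltaHyperbolic.gromovProduct_sub_mem_Icc (hX : IsDeltaHyperbolic δ X) {x y u v t : X}
    {T C : ℝ} (hxy : dist x y ≤ T + C) (ht : T - C ≤ gromovProduct x y t)
    (hu : T - C - 2 * δ ≤ gromovProduct x u t) (hv : T - C - 2 * δ ≤ gromovProduct x v t)
    (hδ : 0 ≤ δ) :
    gromovProduct x u v - gromovProduct y u v ∈ Icc (T - (3 * C + 6 * δ)) (T + C) := by
  rw [gromovProduct_sub_gromovProduct]
  rw [gromovProduct_comm] at hu hv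
  have h1 := hX.le_gromovProduct (r := T - C - 2 * δ) (by linarith) hu
  have h2 := hX.le_gromovProduct (r := T - C - 2 * δ) (by linarith) hv
  have h3 := gromovProduct_le_dist x y u
  have h4 := gromovProduct_le_dist x y v
  constructor <;> linarith

variable [MetricSpace (GromovBoundary X)] {a : ℝ} {x : X}

/-- Let `y` be at distance about `T` from `x` in the direction of `z`, and let `g` be an isometry
moving `y` to within `D` of `x`. Then `g` expands the ball of radius `c * exp (-(a * T))` about `z`
by the factor `exp (a * T)`, up to a multiplicative constant. -/
theorem IsStandardVisualMetric.dist_boundaryMap_bounds (hD : IsStandardVisualMetric δ a x)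
    (hX : IsDeltaHyperbolic δ X) (hc : 0 < 3 - 2 * Real.exp (a * δ)) {z : GromovBoundary X}
    {t : ℕ → X} (ht : ConvergesToBoundary t z) {y : X} {T C D : ℝ} (hC : 0 ≤ C)
    (hxy : dist x y ≤ T + C) (hyt : ∀ᶠ n in atTop, T - C ≤ gromovProduct x y (t n))
    {g : X ≃ᵢ X} (hg : dist (g y) x ≤ D) {w w' : GromovBoundary X}
    (hw : dist w z < (3 - 2 * Real.exp (a * δ)) * Real.exp (-(a * T)))
    (hw' : dist w' z < (3 - 2 * Real.exp (a * δ)) * Real.exp (-(a * T))) :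
    dist (boundaryMap g w) (boundaryMap g w') ≤
        Real.exp (a * (T + (D + 3 * C + 6 * δ) + 2 * δ)) / (3 - 2 * Real.exp (a * δ)) *
          dist w w' ∧
      dist w w' ≤
        Real.exp (a * (-T + (D + 3 * C + 6 * δ) + 2 * δ)) / (3 - 2 * Real.exp (a * δ)) *
          dist (boundaryMap g w) (boundaryMap g w') := by
  have hδ := hX.nonneg x
  obtain ⟨u, hu⟩ := w.exists_convergesToBoundary
  obtain ⟨v, hv⟩ := w'.exists_convergesToBoundary
  obtain ⟨N0, h0⟩ := eventually_atTop.1 hyt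
  obtain ⟨N1, h1⟩ := eventually_atTop_prod_self.1 (hD.eventually_le_gromovProduct hX hu ht hw)
  obtain ⟨N2, h2⟩ := eventually_atTop_prod_self.1 (hD.eventually_le_gromovProduct hX hv ht hw')
  set k := max N0 (max N1 N2)
  have k0 : N0 ≤ k := le_max_left _ _
  have k1 : N1 ≤ k := (le_max_left _ _).trans (le_max_right _ _)
  have k2 : N2 ≤ k := (le_max_right _ _).trans (le_max_right _ _)
  have hgy : dist (g.symm x) y ≤ D := by
    rwa [← g.dist_eq, g.apply_symm_apply, dist_comm]
  have key : ∀ i j, k ≤ i → k ≤ j →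
      gromovProduct x (u i) (v j) ≤
        gromovProduct x (g (u i)) (g (v j)) + (T + (D + 3 * C + 6 * δ)) ∧
      gromovProduct x (g (u i)) (g (v j)) ≤
        gromovProduct x (u i) (v j) + (-T + (D + 3 * C + 6 * δ)) := by
    intro i j hi hj
    rw [gromovProduct_isometryEquiv]
    have e1 := h1 i k (k1.trans hi) k1
    have e2 := h2 j k (k2.trans hj) k2
    dsimp only at e1 e2
    have e3 := hX.gromovProduct_sub_mem_Icc hxy (h0 k k0) (e1.trans' (by linarith))
      (e2.trans' (by linarith)) hδ
    have e4 := gromovProduct_le_add_dist_base (g.symm x) y (u i) (v j)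
    have e5 := gromovProduct_le_add_dist_base y (g.symm x) (u i) (v j)
    rw [dist_comm] at e5
    constructor <;> linarith [e3.1, e3.2]
  exact ⟨hD.dist_le_mul_dist hX hc hu hv (hu.map g) (hv.map g)
      (eventually_atTop_prod_self.2 ⟨k, fun i j hi hj => (key i j hi hj).1⟩),
    hD.dist_le_mul_dist hX hc (hu.map g) (hv.map g) hu hv
      (eventually_atTop_prod_self.2 ⟨k, fun i j hi hj => (key i j hi hj).2⟩)⟩

/-- In the situation of `IsStandardVisualMetric.dist_boundaryMap_bounds`, a boundary point whose
image under `g` is close to that of `z` lies in a small ball about `z`. -/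
theorem IsStandardVisualMetric.dist_le_of_dist_boundaryMap_lt (hD : IsStandardVisualMetric δ a x)
    (hX : IsDeltaHyperbolic δ X) {z : GromovBoundary X}
    {t : ℕ → X} (ht : ConvergesToBoundary t z) {y : X} {T C D s : ℝ}
    (hC : 0 ≤ C) (hs : 0 < s) (hxy : dist x y ≤ T + C)
    (hyt : ∀ᶠ n in atTop, T - C ≤ gromovProduct x y (t n))
    {g : X ≃ᵢ X} (hg : dist (g y) x ≤ D) {w : GromovBoundary X}
    (hw : dist (boundaryMap g w) (boundaryMap g z) <
      (3 - 2 * Real.exp (a * δ)) * Real.exp (-(a * (D + 3 * C + 3 * δ + s)))) :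
    dist w z ≤ Real.exp (-(a * (T + s))) := by
  have hδ := hX.nonneg x
  obtain ⟨u, hu⟩ := w.exists_convergesToBoundary
  obtain ⟨N0, h0⟩ := eventually_atTop.1 hyt
  obtain ⟨N1, h1⟩ := eventually_atTop_prod_self.1
    (hD.eventually_le_gromovProduct hX (hu.map g) (ht.map g) hw)
  have hgy : dist (g.symm x) y ≤ D := by
    rwa [← g.dist_eq, g.apply_symm_apply, dist_comm]
  refine hD.dist_le hu ht (eventually_atTop_prod_self.2 ⟨max N0 N1, fun i j hi hj => ?_⟩)
  have e1 := h1 i j ((le_max_right _ _).trans hi) ((le_max_right _ _).trans hj)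
  have e0 := h0 j ((le_max_left _ _).trans hj)
  dsimp only at e1 ⊢
  rw [gromovProduct_isometryEquiv] at e1
  have e2 := gromovProduct_le_add_dist_base (g.symm x) y (u i) (t j)
  -- Seen from `y`, the points `x` and `t j` lie in different directions; hence so do `x` and `u i`.
  have e3 := gromovProduct_add_gromovProduct x y (t j)
  have e4 := gromovProduct_add_gromovProduct x y (u i)
  have e5 : gromovProduct y x (u i) ≤ 2 * C + δ := by
    by_contra! hlt
    have := hX x (u i) (t j) y
    have := lt_min hlt (show 2 * C + δ < gromovProduct y (u i) (t j) by linarith)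
    linarith
  have e6 := gromovProduct_sub_gromovProduct x y (u i) (t j)
  linarith

end Rescaling

theorem mainTheorem4 (δ D : ℝ) (hδ : 0 < δ) (hD : 0 ≤ D) :
    ∃ L₀ ρ₀ : ℝ, 1 ≤ L₀ ∧ 0 < ρ₀ ∧
      ∀ (X : Type*) [MetricSpace X] (x : X) (Γ : Subgroup (X ≃ᵢ X)), MClass δ D x Γ →
        ∀ [MetricSpace (GromovBoundary X)], IsStandardVisualMetric δ (visualParameter δ) x →
          IsQuasiSelfSimilar L₀ ρ₀ (limitSet Γ) ∧
          ∀ (z : limitSet Γ) (ρ : ℝ) (hρ : 0 < ρ), ρ ≤ ρ₀ →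
            ∃ g ∈ Γ, ∃ Φ : Metric.ball z ρ → limitSet Γ,
              IsRescalingMap L₀ ρ₀ z ρ hρ Φ ∧
              ∀ w : Metric.ball z ρ,
                (Φ w : GromovBoundary X) = boundaryMap g (w : limitSet Γ) := by
  have ha := visualParameter_pos hδ
  have hc := visualParameter_const_pos hδ
  set a := visualParameter δ
  set c := 3 - 2 * Real.exp (a * δ) with hcdef
  -- The constant `C` is the distance from `x` to the lines of `exists_line_of_mem_quasiconvexHull`,
  -- and `s` is so large that `exp (-(a * s)) < c`.
  set C := 3 * δ + 1 with hCdef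
  have hC : 0 ≤ C := by positivity
  obtain ⟨s, hs1, hs⟩ := exists_exp_neg_mul_lt ha hc 1
  set M := D + 3 * C + 8 * δ + s with hM
  have hM0 : 0 ≤ M := by positivity
  have hL1 : 1 ≤ Real.exp (a * M) := Real.one_le_exp (by positivity)
  have hL0 := Real.exp_pos (a * M)
  refine ⟨Real.exp (a * M), c, hL1, hc, fun X _ x Γ hΓ _ hvis => ?_⟩
  have hX := hΓ.hyperbolic
  have hG := hΓ.geodesic
  have := hΓ.proper
  have main : ∀ (z : limitSet Γ) (ρ : ℝ) (hρ : 0 < ρ), ρ ≤ c →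
      ∃ g ∈ Γ, ∃ Φ : Metric.ball z ρ → limitSet Γ,
        IsRescalingMap (Real.exp (a * M)) c z ρ hρ Φ ∧
        ∀ w : Metric.ball z ρ, (Φ w : GromovBoundary X) = boundaryMap g (w : limitSet Γ) := by
    intro z ρ hρ hρc
    obtain ⟨γ, hγ, hγC, hγz, hγx⟩ :=
      exists_line_of_mem_quasiconvexHull hG hX hΓ.base_mem z.2
    -- The time `T ≥ 0` at which the line towards `z` has to be followed to see the scale `ρ`.
    obtain ⟨T, hT0, hT⟩ : ∃ T : ℝ, 0 ≤ T ∧ Real.exp (a * T) = c / ρ := by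
      refine ⟨Real.log (c / ρ) / a, div_nonneg (Real.log_nonneg ((one_le_div hρ).2 hρc)) ha.le, ?_⟩
      rw [mul_div_cancel₀ _ ha.ne', Real.exp_log (by positivity)]
    have hρT : c * Real.exp (-(a * T)) = ρ := by
      rw [Real.exp_neg, hT]
      field_simp
    have hγT : dist (γ 0) (γ T) = T := by
      rw [hγ.dist_eq, Real.dist_eq, zero_sub, abs_neg, abs_of_nonneg hT0]
    have hxy : dist x (γ T) ≤ T + C := by linarith [dist_triangle x (γ 0) (γ T)]
    have hyt : ∀ᶠ n : ℕ in atTop, T - C ≤ gromovProduct x (γ T) (γ n) := by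
      obtain ⟨N, hN⟩ := exists_nat_ge T
      refine eventually_atTop.2 ⟨N, fun n hn => ?_⟩
      have hn : T ≤ n := hN.trans (by exact_mod_cast hn)
      have h1 := gromovProduct_le_add_dist_base (γ 0) x (γ T) (γ n)
      have h2 : gromovProduct (γ 0) (γ T) (γ n) = T := by
        rw [gromovProduct, hγT, hγ.dist_eq, hγ.dist_eq, Real.dist_eq, Real.dist_eq,
          abs_of_nonpos (by linarith), abs_of_nonpos (by linarith)]
        ring
      rw [dist_comm] at h1
      linarith
    obtain ⟨g, hgΓ, hg⟩ := hΓ.cocompact _ (hγC T) x hΓ.base_mem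
    refine ⟨g, hgΓ, fun w => ⟨boundaryMap g (w : limitSet Γ), boundaryMap_mem_limitSet hgΓ w.1.2⟩,
      ⟨fun w w' => ?_, fun v hv => ?_⟩, fun w => rfl⟩
    · have hb : ∀ w : Metric.ball z ρ, dist (w.1 : GromovBoundary X) z < c * Real.exp (-(a * T)) :=
        fun w => by rw [hρT]; exact w.2
      obtain ⟨h1, h2⟩ := hvis.dist_boundaryMap_bounds hX hc hγz hC hxy hyt hg (hb w) (hb w')
      rw [← hcdef] at h1 h2
      have hexp : Real.exp (a * (D + 3 * C + 6 * δ + 2 * δ)) / c ≤ Real.exp (a * M) := by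
        rw [div_le_iff₀ hc]
        calc _ = Real.exp (a * M) * Real.exp (-(a * s)) := by
              rw [← Real.exp_add, hM]; ring_nf
          _ ≤ _ := by gcongr
      have f1 : Real.exp (a * (T + (D + 3 * C + 6 * δ) + 2 * δ)) / c ≤
          Real.exp (a * M) * (c / ρ) := by
        calc _ = Real.exp (a * (D + 3 * C + 6 * δ + 2 * δ)) / c * Real.exp (a * T) := by
              rw [div_mul_eq_mul_div, ← Real.exp_add]; ring_nf
          _ ≤ _ := by rw [hT]; gcongr
      have f2 : Real.exp (a * (-T + (D + 3 * C + 6 * δ) + 2 * δ)) / c ≤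
          Real.exp (a * M) * (ρ / c) := by
        calc _ = Real.exp (a * (D + 3 * C + 6 * δ + 2 * δ)) / c * (Real.exp (a * T))⁻¹ := by
              rw [← Real.exp_neg, div_mul_eq_mul_div, ← Real.exp_add]; ring_nf
          _ ≤ _ := by rw [hT, inv_div]; gcongr
      have g1 := h1.trans (mul_le_mul_of_nonneg_right f1 dist_nonneg)
      have g2 := h2.trans (mul_le_mul_of_nonneg_right f2 dist_nonneg)
      refine ⟨?_, by rw [← mul_assoc]; exact g1⟩
      rw [one_div, inv_mul_le_iff₀ hL0, ← le_div_iff₀' (by positivity)]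
      refine g2.trans_eq ?_
      change _ = Real.exp (a * M) * dist (boundaryMap g w.1) (boundaryMap g w'.1) / (c / ρ)
      field_simp
    · set w := boundaryMap g⁻¹ (v : GromovBoundary X) with hw
      have hgw : boundaryMap g w = v := boundaryMap_apply_inv g _
      have hwΓ : w ∈ limitSet Γ := boundaryMap_mem_limitSet (Γ.inv_mem hgΓ) v.2
      have hv' : dist (v : GromovBoundary X) (boundaryMap g z) < c / Real.exp (a * M) := hv
      have hlt : dist (boundaryMap g w) (boundaryMap g z) <
          c * Real.exp (-(a * (D + 3 * C + 3 * δ + s))) := by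
        rw [hgw]
        refine hv'.trans_le ?_
        rw [div_eq_mul_inv, ← Real.exp_neg]
        gcongr
        linarith
      have h1 := hvis.dist_le_of_dist_boundaryMap_lt hX hγz hC (by linarith) hxy hyt hg hlt
      have h2 : dist w z < ρ := by
        refine h1.trans_lt ?_
        rw [← hρT, mul_add, neg_add, Real.exp_add, mul_comm]
        gcongr
      exact ⟨⟨⟨w, hwΓ⟩, h2⟩, Subtype.ext hgw⟩
  exact ⟨⟨hL1, hc, hvis.compactSpace_limitSet hG hX hc Γ, fun z ρ hρ hle =>
    let ⟨_, _, Φ, hΦ, _⟩ := main z ρ hρ hle; ⟨Φ, hΦ⟩⟩, main⟩
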